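/- Let $K$ be a tame link in $S^3$ with components $K_1,\dots,K_c$ ($c\ge 1$), i.e. the image of a topological embedding of $c$ disjoint circles that an ambient isotopy carries onto a link made of finitely many straight-line segments in $\mathbb{R}^3\subset S^3=\mathbb{R}^3\cup\{\infty\}$. Let $V_1,\dots,V_c$ be tubular neighbourhoods of the components: open solid tori with cores $K_1,\dots,K_c$ and with pairwise disjoint closures, given by parametrizations of $S^1\times\{w\in\mathbb{C}:|w|<1\}$ that extend to open embeddings of $S^1\times\mathbb{C}$ in $S^3$. Let $X=S^3\setminus\bigcup_i V_i$ be the link exterior and $G=\pi_1(X,x)$ the link group, where $x\in X$. Assume that $K$ is peripherally nontrivial: for every $i$ the peripheral subgroup of $K_i$ (the image of $\pi_1(\partial V_i)$ in the link group, generated by a meridian and a longitude of $K_i$) is isomorphic to $\mathbb{Z}^2$. Let $U\trianglelefteq G$ be a normal subgroup of finite index and let $\pi\colon X_U\to X$ be the finite covering induced by $U$, i.e. the path-connected covering, unique up to isomorphism, for which $\pi$ maps $\pi_1(X_U,e)$ onto $U$ for some point $e$ over $x$ (equivalently, the quotient by $U$ of the universal covering of $X$). Then $$G=U\quad\Longleftrightarrow\quad\text{for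 every } i=1,\dots,c,\ \text{the number of connected components of } \pi^{-1}(\partial V_i) \text{ equals } |G:U|.$$ -/

import Mathlib

open Set Topology

/-- The 3-sphere, as the one-point compactification of Euclidean 3-space. -/
abbrev S3 : Type := OnePoint (EuclideanSpace ℝ (Fin 3))

/-- A `c`-component link: a topological embedding of the disjoint union of `c` circles in the
3-sphere. -/
structure Link (c : ℕ) where
  toFun : Fin c × Circle → S3
  isEmbedding : IsEmbedding toFun

namespace Link

variable {c : ℕ}

/-- The `i`-th component of the link. -/
def component (L : Link c) (i : Fin c) : Set S3 := range fun z : Circle => L.toFun (i, z)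

/-- The link as a subset of the 3-sphere. -/
def carrier (L : Link c) : Set S3 := range L.toFun

/-- A link is polygonal if it lies in Euclidean 3-space and each of its components is a union of
finitely many closed straight-line segments. -/
def IsPolygonal (L : Link c) : Prop :=
  ∀ i, ∃ s : Finset (EuclideanSpace ℝ (Fin 3) × EuclideanSpace ℝ (Fin 3)),
    L.component i = ((↑) : EuclideanSpace ℝ (Fin 3) → S3) '' ⋃ q ∈ s, segment ℝ q.1 q.2

/-- Two links are equivalent if an isotopic deformation of the 3-sphere maps the first onto the
second. -/
def Equivalent (L K : Link c) : Prop :=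
  ∃ D : S3 × unitInterval → S3, Continuous D ∧
    (∀ t, IsHomeomorph fun x => D (x, t)) ∧
    (∀ x, D (x, 0) = x) ∧
    (fun x => D (x, 1)) '' L.carrier = K.carrier

/-- A link is tame if it is equivalent to a polygonal one. -/
def IsTame (L : Link c) : Prop := ∃ P : Link c, P.IsPolygonal ∧ L.Equivalent P

/-- A tubular neighbourhood of a link: for each component an open solid torus
`V i ≅ S¹ × {w | ‖w‖ < 1}` having that component as its core. The parametrization of the solid
torus extends to an open embedding of `S¹ × ℂ` (so that `∂ (V i)` is a bicollared torus), and
the images of these embeddings are pairwise disjoint (so that the closed solid tori are). -/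
structure TubularNeighbourhood (L : Link c) where
  param : Fin c → Circle × ℂ → S3
  isOpenEmbedding : ∀ i, IsOpenEmbedding (param i)
  core : ∀ i z, param i (z, 0) = L.toFun (i, z)
  disjoint : Pairwise fun i j => Disjoint (range (param i)) (range (param j))

namespace TubularNeighbourhood

variable {L : Link c} (V : L.TubularNeighbourhood)

/-- The open solid torus `V i` around the `i`-th component. -/
def solidTorus (i : Fin c) : Set S3 := V.param i '' {q | ‖q.2‖ < 1}

/-- The link exterior `X`: the complement in the 3-sphere of the open solid tori. -/
def exterior : Set S3 := (⋃ i, V.solidTorus i)ᶜ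

/-- The boundary torus `∂ (V i)`, as a subset of the exterior. -/
def boundary (i : Fin c) : Set V.exterior := {x | (x : S3) ∈ frontier (V.solidTorus i)}

/-- The link group: the fundamental group of the link exterior. -/
abbrev group (x : V.exterior) : Type := FundamentalGroup V.exterior x

/-- The peripheral subgroup of the `i`-th component, based at a point `y` of `∂ (V i)`: the image
in the link group of the fundamental group of the torus `∂ (V i)`, which is generated by a
meridian and a longitude. -/
noncomputable def peripheralSubgroup (i : Fin c) (y : V.boundary i) : Subgroup (V.group y) :=
  (FundamentalGroup.map (⟨Subtype.val, continuous_subtype_val⟩ : C(V.boundary i, V.exterior))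
    y).range

/-- The peripheral subgroups of all the components are isomorphic to `ℤ²`. -/
def IsPeripherallyNontrivial : Prop :=
  ∀ (i : Fin c) (y : V.boundary i),
    Nonempty (V.peripheralSubgroup i y ≃* Multiplicative (ℤ × ℤ))

end TubularNeighbourhood

end Link

/-- `p : E → X` is the covering induced by the subgroup `U` of `π₁(X, x)`: it is a path-connected
covering of `X`, and `e` is a point over `x` such that `p` maps `π₁(E, e)` onto `U`.
(Up to isomorphism this is the quotient of the universal covering of `X` by `U`.) -/
structure IsCoveringInducedBy {X E : Type*} [TopologicalSpace X] [TopologicalSpace E] {x : X}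
    (U : Subgroup (FundamentalGroup X x)) (p : C(E, X)) (e : E) : Prop where
  isCoveringMap : IsCoveringMap p
  pathConnectedSpace : PathConnectedSpace E
  map_eq : p e = x
  range_eq : (FundamentalGroup.mapOfEq p map_eq).range = U

/-! If π⁻¹(∂V_i) has |G:U| components, i.e. as many as a fibre has points, then each component meets
each fibre over ∂V_i exactly once, so the covering is trivial over that torus. It therefore extends
trivially across the removed solid tori to a covering of S³. As S³ is simply connected, the
extension has a section through any point; restricted to X it gives a section s of π through e.
Since X_U is connected, s ∘ π = id by uniqueness of lifts, so π is injective and |G:U| = 1.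
Conversely, if U = G then the fibres are single points, and every component of π⁻¹(∂V_i) meets each
fibre over the torus.

No spaces are glued. The extension is the pullback of π along the radial retraction S³ → X, which is
discontinuous on the cores: `HasCoveringSections.exists_lift` builds it as a bundle with discrete
fibre, and `exists_section` applies this to the exterior. Simple connectedness of S³ enters only as
`HasCoveringSections`. -/

/-- A pairing of an open map with a continuous map to a discrete space is open. -/
theorem IsOpenMap.prodMk_discrete {Y Z D : Type*} [TopologicalSpace Y] [TopologicalSpace Z]
    [TopologicalSpace D] [DiscreteTopology D] {f : Y → Z} {g : Y → D} (hf : IsOpenMap f)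
    (hg : Continuous g) : IsOpenMap fun y => (f y, g y) := by
  intro W hW
  have : (fun y => (f y, g y)) '' W = ⋃ d, (f '' (W ∩ g ⁻¹' {d})) ×ˢ {d} := by
    ext ⟨z, d⟩
    simp only [mem_image, Prod.mk.injEq, mem_iUnion, mem_prod, mem_inter_iff, mem_preimage,
      mem_singleton_iff]
    constructor
    · rintro ⟨y, hy, rfl, rfl⟩
      exact ⟨g y, ⟨y, ⟨hy, rfl⟩, rfl⟩, rfl⟩
    · rintro ⟨d', ⟨y, ⟨hy, h⟩, rfl⟩, rfl⟩
      exact ⟨y, hy, rfl, h⟩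
  rw [this]
  exact isOpen_iUnion fun d =>
    (hf _ (hW.inter ((isOpen_discrete {d}).preimage hg))).prod (isOpen_discrete _)

theorem ConnectedComponents.discreteTopology_of_finite {Y : Type*} [TopologicalSpace Y]
    [Finite (ConnectedComponents Y)] : DiscreteTopology (ConnectedComponents Y) := by
  infer_instance

/-! ### Fibres, and components over path-connected sets. -/

namespace IsCoveringMap

variable {X E : Type*} [TopologicalSpace X] [TopologicalSpace E] {p : C(E, X)}

/-- The fibers of a covering with path-connected total space are equinumerous, as long as they
are nonempty. -/
theorem nonempty_fiber_equiv [PathConnectedSpace E] (hp : IsCoveringMap p) (e e' : E) :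
    Nonempty (p ⁻¹' {p e} ≃ p ⁻¹' {p e'}) :=
  ⟨Equiv.ofBijective _ (hp.monodromy_bijective
    (.mk ((PathConnectedSpace.somePath e e').map p.continuous)))⟩

/-- Every component of the preimage of a path-connected set meets every fiber over this set. -/
theorem surjective_fiber_connectedComponents (hp : IsCoveringMap p) {D : Set X}
    (hD : IsPathConnected D) {y : X} (hy : y ∈ D) :
    Function.Surjective fun e : p ⁻¹' {y} =>
      ConnectedComponents.mk (⟨e, by rw [mem_preimage, e.2]; exact hy⟩ : p ⁻¹' D) := by
  intro c
  obtain ⟨⟨ε, hε⟩, rfl⟩ := ConnectedComponents.surjective_coe c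
  obtain ⟨γ, hγ⟩ := hD.joinedIn _ hε _ hy
  let Γ := hp.liftPath γ ε γ.source
  have hΓ : ∀ t, p (Γ t) = γ t := fun t => congrFun (hp.liftPath_lifts γ ε γ.source) t
  refine ⟨⟨Γ 1, by simp [hΓ]⟩, ?_⟩
  rw [ConnectedComponents.coe_eq_coe']
  have hj : Joined (⟨ε, hε⟩ : p ⁻¹' D) ⟨Γ 1, by rw [mem_preimage, hΓ]; exact hγ 1⟩ :=
    ⟨⟨⟨fun t => ⟨Γ t, by rw [mem_preimage, hΓ]; exact hγ t⟩, by fun_prop⟩,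
      Subtype.ext (hp.liftPath_zero γ ε γ.source), rfl⟩⟩
  exact pathComponent_subset_component _ hj

/-- A covering is trivial over a path-connected set if the preimage of this set has as many
components as the fibers have points. -/
theorem exists_homeomorph_prod (hp : IsCoveringMap p) {D : Set X} (hD : IsPathConnected D)
    {F : Type*} [TopologicalSpace F] [DiscreteTopology F] [Finite F] [Nonempty F]
    (hF : ∀ y ∈ D, Nat.card (p ⁻¹' {y}) = Nat.card F)
    (hc : Nat.card (ConnectedComponents (p ⁻¹' D)) = Nat.card F) :
    ∃ Φ : p ⁻¹' D ≃ₜ D × F, ∀ z, ((Φ z).1 : X) = p z := by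
  have hpos : Nat.card F ≠ 0 := Nat.card_pos.ne'
  have : Finite (ConnectedComponents (p ⁻¹' D)) := Nat.finite_of_card_ne_zero (hc ▸ hpos)
  have := ConnectedComponents.discreteTopology_of_finite (Y := p ⁻¹' D)
  let g : p ⁻¹' D → D × ConnectedComponents (p ⁻¹' D) :=
    fun z => (D.restrictPreimage p z, ConnectedComponents.mk z)
  have hopen : IsOpenMap g :=
    (hp.isOpenMap.restrictPreimage D).prodMk_discrete ConnectedComponents.continuous_coe
  have hcont : Continuous g :=
    (p.continuous.restrictPreimage).prodMk ConnectedComponents.continuous_coe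
  -- A surjection between finite sets of equal cardinality is bijective.
  have hinj : ∀ y (hy : y ∈ D), Function.Bijective fun e : p ⁻¹' {y} =>
      ConnectedComponents.mk (⟨e, by rw [mem_preimage, e.2]; exact hy⟩ : p ⁻¹' D) := by
    intro y hy
    have : Finite (p ⁻¹' {y}) := Nat.finite_of_card_ne_zero (hF y hy ▸ hpos)
    exact (Nat.bijective_iff_surjective_and_card _).2
      ⟨hp.surjective_fiber_connectedComponents hD hy, (hF y hy).trans hc.symm⟩
  have hbij : Function.Bijective g := by
    constructor
    · rintro ⟨a, ha⟩ ⟨b, hb⟩ hab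
      have h1 : p a = p b := congrArg (fun q => (q.1 : X)) hab
      have h2 := congrArg Prod.snd hab
      exact Subtype.ext (congrArg (fun q : p ⁻¹' {p a} => (q : E))
        ((hinj _ ha).1 (a₁ := ⟨a, rfl⟩) (a₂ := ⟨b, h1.symm⟩) h2))
    · rintro ⟨⟨y, hy⟩, c⟩
      obtain ⟨⟨a, ha⟩, rfl⟩ := (hinj y hy).2 c
      exact ⟨⟨a, by rw [mem_preimage, show p a = y from ha]; exact hy⟩,
        Prod.ext (Subtype.ext ha) rfl⟩
  obtain ⟨e₁⟩ := Finite.card_eq.1 hc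
  exact ⟨((Equiv.ofBijective g hbij).toHomeomorphOfContinuousOpen hcont hopen).trans
    ((Homeomorph.refl D).prodCongr e₁.toHomeomorphOfDiscrete), fun _ => rfl⟩

end IsCoveringMap

/-- The index of the subgroup inducing a covering is the cardinality of the fiber. -/
theorem IsCoveringInducedBy.card_fiber {X E : Type*} [TopologicalSpace X] [TopologicalSpace E]
    {x : X} {U : Subgroup (FundamentalGroup X x)} {p : C(E, X)} {e : E}
    (h : IsCoveringInducedBy U p e) : Nat.card (p ⁻¹' {x}) = U.index := by
  have hp := h.isCoveringMap
  have := h.pathConnectedSpace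
  obtain ⟨-, -, rfl, hr⟩ := h
  let := hp.fundamentalGroupMulAction (p e)
  have htr : MulAction.IsPretransitive (FundamentalGroup X (p e)) (p ⁻¹' {p e}) := by
    refine MulAction.isPretransitive_iff_base ⟨e, rfl⟩ |>.2 fun e' => ?_
    let Γ := PathConnectedSpace.somePath e e'.1
    exact ⟨.mk ((Γ.map p.continuous).cast rfl e'.2.symm),
      hp.monodromy_eq_of_map_eq (ex := ⟨e, rfl⟩) (.mk Γ) rfl⟩
  -- A loop fixes `e` under monodromy exactly when its lift from `e` closes up, that is, when it is
  -- the image of a loop at `e`.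
  have hst : MulAction.stabilizer (FundamentalGroup X (p e)) (⟨e, rfl⟩ : p ⁻¹' {p e}) = U := by
    ext γ
    rw [← hr, MulAction.mem_stabilizer_iff]
    constructor
    · intro hγ
      refine ⟨(hp.liftPathQuotient γ ⟨e, rfl⟩).cast rfl congr($hγ.symm), ?_⟩
      rw [FundamentalGroup.mapOfEq_apply, Path.Homotopic.Quotient.map_cast]
      erw [IsCoveringMap.map_liftPathQuotient]
      simp only [Path.Homotopic.Quotient.cast_cast]
      exact (Path.Homotopic.Quotient.cast_cast
        (γ : Path.Homotopic.Quotient (p e) (p e)) _ _ _ _).trans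
        (Path.Homotopic.Quotient.cast_rfl_rfl _)
    · rintro ⟨δ, rfl⟩
      refine hp.monodromy_eq_of_map_eq (ex := ⟨e, rfl⟩) (ey := ⟨e, rfl⟩) δ ?_
      rw [FundamentalGroup.mapOfEq_apply]
      simp only [Path.Homotopic.Quotient.cast_rfl_rfl]
      rfl
  rw [← hst, MulAction.index_stabilizer_of_transitive]

/-! ### Sections of coverings of the 3-sphere. -/

/-- Every covering of `B` has a global section through any given point of the covering space. -/
def HasCoveringSections.{u, v} (B : Type v) [TopologicalSpace B] : Prop :=
  ∀ (T : Type u) [TopologicalSpace T] (q : T → B), IsCoveringMap q → ∀ t : T,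
    ∃ s : C(B, T), (∀ b, q (s b) = b) ∧ s (q t) = t

namespace HasCoveringSections

theorem of_homeomorph.{u, v, w} {B : Type v} {B' : Type w} [TopologicalSpace B]
    [TopologicalSpace B'] (h : B ≃ₜ B') (hB : HasCoveringSections.{u} B') :
    HasCoveringSections.{u} B := by
  intro T _ q hq t
  obtain ⟨s, hs, hst⟩ := hB T _ (hq.homeomorph_comp h) t
  exact ⟨s.comp ⟨h, h.continuous⟩, fun b => h.injective (hs (h b)), hst⟩

/-- A union of two open, simply connected and locally path-connected sets with preconnected
intersection has sections of coverings. -/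
theorem of_union {B : Type*} [TopologicalSpace B] {V W : Set B} (hV : IsOpen V) (hW : IsOpen W)
    [SimplyConnectedSpace V] [LocallyPathConnectedSpace V] [SimplyConnectedSpace W]
    [LocallyPathConnectedSpace W] (hVW : V ∪ W = univ) (hne : (V ∩ W).Nonempty)
    (hpre : IsPreconnected (V ∩ W)) : HasCoveringSections B := by
  intro T _ q hq t
  classical
  have local_section : ∀ (D : Set B) [SimplyConnectedSpace D] [LocallyPathConnectedSpace D] (t : T),
      q t ∈ D → ∃ s : B → T, ContinuousOn s D ∧ (∀ b ∈ D, q (s b) = b) ∧ s (q t) = t := by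
    intro D _ _ t ht
    obtain ⟨s, ⟨hs, hqs⟩, -⟩ := hq.existsUnique_continuousMap_lifts
      (⟨Subtype.val, continuous_subtype_val⟩ : C(D, B)) ⟨q t, ht⟩ t rfl
    -- The value `t` off `D` is a dummy.
    refine ⟨fun b => if hb : b ∈ D then s ⟨b, hb⟩ else t, ?_, fun b hb => ?_, ?_⟩
    · rw [continuousOn_iff_continuous_domRestrict]
      exact s.continuous.congr fun b => by simp [b.2]
    · simpa [hb] using congrFun hqs ⟨b, hb⟩
    · simpa [ht] using hs
  have glue : ∀ (V W : Set B) [SimplyConnectedSpace V] [LocallyPathConnectedSpace V]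
      [SimplyConnectedSpace W] [LocallyPathConnectedSpace W], IsOpen V → IsOpen W →
      V ∪ W = univ → (V ∩ W).Nonempty → IsPreconnected (V ∩ W) → q t ∈ V →
      ∃ s : C(B, T), (∀ b, q (s b) = b) ∧ s (q t) = t := by
    intro V W _ _ _ _ hV hW hVW hne hpre ht
    obtain ⟨s, hs, hqs, hst⟩ := local_section V t ht
    obtain ⟨b, hbV, hbW⟩ := hne
    obtain ⟨s', hs', hqs', hst'⟩ := local_section W (s b) (by rwa [hqs b hbV])
    rw [hqs b hbV] at hst'
    -- Two lifts that agree at one point agree on the preconnected overlap.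
    have heq : (V ∩ W).EqOn s s' := hq.eqOn_of_comp_eqOn hpre (hs.mono inter_subset_left)
      (hs'.mono inter_subset_right) (fun y hy => (hqs y hy.1).trans (hqs' y hy.2).symm)
      ⟨hbV, hbW⟩ hst'.symm
    have hmem : ∀ y, y ∉ V → y ∈ W := fun y hy =>
      ((eq_univ_iff_forall.1 hVW y).resolve_left hy)
    refine ⟨⟨fun y => if y ∈ V then s y else s' y, ?_⟩, fun y => ?_, ?_⟩
    · rw [continuous_iff_continuousAt]
      intro y
      by_cases hy : y ∈ V
      · refine (hs.continuousAt (hV.mem_nhds hy)).congr ?_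
        filter_upwards [hV.mem_nhds hy] with z hz
        rw [if_pos hz]
      · refine (hs'.continuousAt (hW.mem_nhds (hmem y hy))).congr ?_
        filter_upwards [hW.mem_nhds (hmem y hy)] with z hz
        split_ifs with h
        · exact (heq ⟨h, hz⟩).symm
        · rfl
    · by_cases hy : y ∈ V
      · simpa [hy] using hqs y hy
      · simpa [hy] using hqs' y (hmem y hy)
    · simpa [ht] using hst
  rcases eq_univ_iff_forall.1 hVW (q t) with h | h
  · exact glue V W hV hW hVW hne hpre h
  · exact glue W V hW hV (by rwa [union_comm]) (by rwa [inter_comm]) (by rwa [inter_comm]) h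

-- Punctured at `v` or at `-v`, the sphere is a Euclidean space by stereographic projection. The
-- overlap is an `n`-dimensional space minus a point, which is connected because `2 ≤ n`.
open Metric Module in
theorem sphere {n : ℕ} {G : Type*} [NormedAddCommGroup G] [InnerProductSpace ℝ G]
    [Fact (finrank ℝ G = n + 1)] (hn : 2 ≤ n) : HasCoveringSections (sphere (0 : G) 1) := by
  have : FiniteDimensional ℝ G := .of_fact_finrank_eq_succ n
  have hrank : ∀ v : Metric.sphere (0 : G) 1, finrank ℝ (ℝ ∙ (v : G))ᗮ = n := fun v =>
    Submodule.finrank_orthogonal_span_singleton (ne_zero_of_mem_unit_sphere v)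
  have homeo : ∀ v : Metric.sphere (0 : G) 1,
      Nonempty (({v}ᶜ : Set (Metric.sphere (0 : G) 1)) ≃ₜ (ℝ ∙ (v : G))ᗮ) := by
    intro v
    have hv : ‖(v : G)‖ = 1 := norm_eq_of_mem_sphere v
    let f := stereographic hv
    have h1 : f.source = {v}ᶜ := by simp [f]
    have h2 : f.target = univ := stereographic_target hv
    exact ⟨(Homeomorph.setCongr h1.symm).trans (f.toHomeomorphSourceTarget.trans
      ((Homeomorph.setCongr h2).trans (Homeomorph.Set.univ _)))⟩
  have hsc : ∀ v : Metric.sphere (0 : G) 1,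
      SimplyConnectedSpace ({v}ᶜ : Set (Metric.sphere (0 : G) 1)) := fun v => by
    obtain ⟨h⟩ := homeo v
    have : ContractibleSpace ({v}ᶜ : Set (Metric.sphere (0 : G) 1)) := h.contractibleSpace
    infer_instance
  have hlpc : ∀ v : Metric.sphere (0 : G) 1,
      LocallyPathConnectedSpace ({v}ᶜ : Set (Metric.sphere (0 : G) 1)) := fun v => by
    obtain ⟨h⟩ := homeo v
    exact h.isOpenEmbedding.locallyPathConnectedSpace
  have hG : Nontrivial G := Module.nontrivial_of_finrank_pos (R := ℝ) (by
    rw [Fact.out (p := finrank ℝ G = n + 1)]; omega)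
  obtain ⟨v₀, hv₀⟩ := (NormedSpace.sphere_nonempty (x := (0 : G)) (r := 1)).2 zero_le_one
  let v : Metric.sphere (0 : G) 1 := ⟨v₀, hv₀⟩
  have hne : -v ∉ ({v} : Set _) := by
    intro h
    exact ne_neg_of_mem_unit_sphere ℝ v (mem_singleton_iff.1 h).symm
  obtain ⟨h⟩ := homeo v
  have hconn : IsConnected (({v}ᶜ : Set (Metric.sphere (0 : G) 1)) ∩ {-v}ᶜ) := by
    have hr : 1 < Module.rank ℝ (ℝ ∙ (v : G))ᗮ := by
      rw [← finrank_eq_rank, hrank]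
      exact_mod_cast hn
    have h0 := isConnected_compl_singleton_of_one_lt_rank hr (h ⟨-v, hne⟩)
    have h1 := (h0.image h.symm h.symm.continuous.continuousOn).image Subtype.val
      continuous_subtype_val.continuousOn
    convert h1 using 1
    ext y
    constructor
    · rintro ⟨hy, hy'⟩
      refine ⟨⟨y, hy⟩, ⟨h ⟨y, hy⟩, fun hc => hy' ?_, by simp⟩, rfl⟩
      exact congrArg Subtype.val (h.injective hc)
    · rintro ⟨_, ⟨z, hz, rfl⟩, rfl⟩
      refine ⟨(h.symm z).2, fun hc => hz ?_⟩
      rw [mem_singleton_iff] at hc ⊢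
      rw [← h.apply_symm_apply z]
      exact congrArg h (Subtype.ext hc)
  have := hsc v
  have := hsc (-v)
  have := hlpc v
  have := hlpc (-v)
  refine of_union (isOpen_compl_singleton (x := v)) (isOpen_compl_singleton (x := -v)) ?_
    hconn.nonempty hconn.isPreconnected
  rw [← compl_inter, compl_univ_iff]
  exact disjoint_iff_inter_eq_empty.1 (disjoint_singleton.2 fun hc => hne hc.symm)

theorem onePoint_euclideanSpace : HasCoveringSections S3 := by
  have : Fact (Module.finrank ℝ (EuclideanSpace ℝ (Fin 4)) = 3 + 1) := ⟨by simp⟩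
  exact of_homeomorph (onePointEquivSphereOfFinrankEq (ι := Fin 4) (by simp))
    (sphere (n := 3) (by norm_num))

end HasCoveringSections

/-! ### Pulling a covering back along a discontinuous map. -/

/-- A map to the base of a covering, not necessarily continuous, has a lift if the covering is
trivialized over subsets whose preimages form an open cover, in such a way that the map is
continuous on the overlaps. -/
theorem HasCoveringSections.exists_lift.{u, v} {B : Type v} {X E ι : Type*} {F : Type u}
    [TopologicalSpace B]
    [TopologicalSpace X] [TopologicalSpace E] [TopologicalSpace F] [DiscreteTopology F]
    (hB : HasCoveringSections.{max u v} B) {p : E → X} {r : B → X} {S : ι → Set B}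
    (hS : ∀ i, IsOpen (S i)) (hcov : ∀ b, ∃ i, b ∈ S i) {N : ι → Set X}
    (hr : ∀ i, MapsTo r (S i) (N i)) (Φ : ∀ i, p ⁻¹' N i ≃ₜ N i × F)
    (hΦ : ∀ i z, ((Φ i z).1 : X) = p z)
    (hc : ∀ i j, i ≠ j → ContinuousOn r (S i ∩ S j)) {b₀ : B} {e₀ : E} (h₀ : p e₀ = r b₀) :
    ∃ s : B → E, (∀ b, p (s b) = r b) ∧ s b₀ = e₀ ∧
      ∀ i, ContinuousOn r (S i) → ContinuousOn s (S i) := by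
  classical
  choose ix hix using hcov
  have h₀' : p e₀ ∈ N (ix b₀) := h₀ ▸ hr _ (hix b₀)
  let f₀ : F := (Φ (ix b₀) ⟨e₀, h₀'⟩).2
  -- `τ i` is the fibre coordinate of the chart `Φ i`, and `σ i` rebuilds a point from its base
  -- point and coordinate; `f₀` and `e₀` are dummies off `N i`.
  let τ : ι → E → F := fun i e => if h : p e ∈ N i then (Φ i ⟨e, h⟩).2 else f₀
  let σ : ι → X × F → E := fun i y => if h : y.1 ∈ N i then (Φ i).symm (⟨y.1, h⟩, y.2) else e₀
  have hpσ : ∀ i y, y.1 ∈ N i → p (σ i y) = y.1 := fun i y hy => by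
    simp only [σ, dif_pos hy]
    rw [← hΦ i, Homeomorph.apply_symm_apply]
  have hτσ : ∀ i y, y.1 ∈ N i → τ i (σ i y) = y.2 := fun i y hy => by
    have h : p ((Φ i).symm (⟨y.1, hy⟩, y.2)) ∈ N i := ((Φ i).symm (⟨y.1, hy⟩, y.2)).2
    simp only [σ, dif_pos hy, τ, dif_pos h]
    simp
  have hστ : ∀ i e, p e ∈ N i → σ i (p e, τ i e) = e := fun i e he => by
    simp only [σ, dif_pos he, τ]
    have : ((⟨p e, he⟩, (Φ i ⟨e, he⟩).2) : N i × F) = Φ i ⟨e, he⟩ :=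
      Prod.ext (Subtype.ext (hΦ i ⟨e, he⟩).symm) rfl
    rw [this, Homeomorph.symm_apply_apply]
  have hτc : ∀ i, ContinuousOn (τ i) (p ⁻¹' N i) := fun i => by
    rw [continuousOn_iff_continuous_domRestrict]
    exact (continuous_snd.comp (Φ i).continuous).congr fun e => by
      simp [τ, dif_pos (show p e ∈ N i from e.2)]
  have hσc : ∀ i, ContinuousOn (σ i) (N i ×ˢ univ) := fun i => by
    rw [continuousOn_iff_continuous_domRestrict]
    have : Continuous fun y : (N i ×ˢ univ : Set (X × F)) =>
        ((Φ i).symm (⟨y.1.1, y.2.1⟩, y.1.2) : E) := by fun_prop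
    exact this.congr fun y => by simp [σ, dif_pos y.2.1]
  -- For `i = j` the coordinate change is the identity, hence continuous even where `r` is not.
  -- Continuity of `r` matters only on overlaps of distinct charts.
  let Z : FiberBundleCore ι B F :=
    { baseSet := S
      isOpen_baseSet := hS
      indexAt := ix
      mem_baseSet_at := hix
      coordChange := fun i j b f => τ j (σ i (r b, f))
      coordChange_self := fun i b hb f => hτσ i _ (hr i hb)
      continuousOn_coordChange := fun i j => by
        by_cases hij : i = j
        · subst hij
          exact continuousOn_snd.congr fun y hy => hτσ i _ (hr i hy.1.1)
        · have h1 : ContinuousOn (fun y : B × F => (r y.1, y.2)) ((S i ∩ S j) ×ˢ univ) :=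
            ((hc i j hij).comp continuousOn_fst fun y hy => hy.1).prodMk continuousOn_snd
          refine (hτc j).comp ((hσc i).comp h1 fun y hy => ⟨hr i hy.1.1, trivial⟩) fun y hy => ?_
          change p (σ i (r y.1, y.2)) ∈ N j
          rw [hpσ i _ (hr i hy.1.1)]
          exact hr j hy.1.2
      coordChange_comp := fun i j k b hb f => by
        have h1 := hpσ i (r b, f) (hr i hb.1.1)
        have h2 := hστ j (σ i (r b, f)) (by rw [h1]; exact hr j hb.1.2)
        rw [h1] at h2
        exact congrArg (τ k) h2 }
  obtain ⟨t, ht, ht₀⟩ := hB Z.TotalSpace _ (FiberBundle.isCoveringMap (F := F) (E := Z.Fiber))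
    ⟨b₀, τ (ix b₀) e₀⟩
  let s : B → E := fun b => σ (ix b) (r b, (t b).2)
  have hps : ∀ b, p (s b) = r b := fun b => hpσ _ _ (hr _ (hix b))
  refine ⟨s, hps, ?_, fun i hri => ?_⟩
  · have : (t b₀).2 = τ (ix b₀) e₀ := by rw [ht₀]
    simp only [s]
    rw [this, ← h₀, hστ _ _ h₀']
  · have h1 : ContinuousOn (fun b => (Z.localTriv i (t b)).2) (S i) :=
      continuousOn_snd.comp ((Z.localTriv i).continuousOn_toFun.comp t.continuous.continuousOn
        fun b hb => by
          change (t b).1 ∈ S i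
          rwa [show (t b).1 = b from ht b]) (mapsTo_univ _ _)
    refine ((hσc i).comp (hri.prodMk h1) fun b hb => ⟨hr i hb, trivial⟩).congr fun b hb => ?_
    -- In the fixed chart `i` the coordinate of `s` is continuous, although `ix b` jumps with `b`.
    have h2 : (Z.localTriv i (t b)).2 = τ i (s b) := by
      rw [Z.localTriv_apply]
      change τ i (σ (ix (t b).1) (r (t b).1, (t b).2)) = _
      rw [ht b]
    simp only [Function.comp, h2]
    rw [← hps b, hστ i _ (by rw [hps]; exact hr i hb)]

/-! ### Boundary tori and cores. -/

namespace Link.TubularNeighbourhood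

variable {c : ℕ} {L : Link c} (V : L.TubularNeighbourhood)

theorem eq_of_param_eq {i j : Fin c} {q q' : Circle × ℂ} (h : V.param i q = V.param j q') :
    i = j ∧ q = q' := by
  have hij : i = j := by
    by_contra hij
    exact disjoint_left.1 (V.disjoint hij) ⟨q, rfl⟩ ⟨q', h.symm⟩
  subst hij
  exact ⟨rfl, (V.isOpenEmbedding i).injective h⟩

theorem param_mem_exterior {i : Fin c} {q : Circle × ℂ} :
    V.param i q ∈ V.exterior ↔ 1 ≤ ‖q.2‖ := by
  simp only [exterior, solidTorus, mem_compl_iff, mem_iUnion, not_exists]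
  constructor
  · intro h
    by_contra! hq
    exact h i ⟨q, hq, rfl⟩
  · rintro h j ⟨q', hq', heq⟩
    obtain ⟨rfl, rfl⟩ := V.eq_of_param_eq heq
    exact absurd (mem_ofPred.1 hq') (not_lt.2 h)

theorem isOpen_solidTorus (i : Fin c) : IsOpen (V.solidTorus i) :=
  (V.isOpenEmbedding i).isOpenMap _ (isOpen_lt (by fun_prop) continuous_const)

theorem frontier_solidTorus (i : Fin c) :
    frontier (V.solidTorus i) = V.param i '' {q | ‖q.2‖ = 1} := by
  have h1 : {q : Circle × ℂ | ‖q.2‖ < 1} = univ ×ˢ Metric.ball 0 1 := by ext; simp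
  have h2 : closure {q : Circle × ℂ | ‖q.2‖ < 1} = univ ×ˢ Metric.closedBall 0 1 := by
    rw [h1, closure_prod_eq, closure_univ, closure_ball _ one_ne_zero]
  have h3 : closure (V.solidTorus i) = V.param i '' (univ ×ˢ Metric.closedBall 0 1) := by
    rw [← h2, solidTorus, image_closure_of_isCompact
      (h2 ▸ isCompact_univ.prod (isCompact_closedBall _ _))
      (V.isOpenEmbedding i).continuous.continuousOn]
  rw [(V.isOpen_solidTorus i).frontier_eq, h3, solidTorus,
    ← image_sdiff (V.isOpenEmbedding i).injective]
  congr 1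
  ext q
  simp [le_antisymm_iff]

theorem isPathConnected_boundary (i : Fin c) : IsPathConnected (V.boundary i) := by
  have hmem : ∀ q : Circle × Circle, V.param i (q.1, q.2) ∈ V.exterior := fun q =>
    V.param_mem_exterior.2 (Circle.norm_coe _).ge
  have hcont : Continuous fun q : Circle × Circle => (⟨V.param i (q.1, q.2), hmem q⟩ : V.exterior) :=
    ((V.isOpenEmbedding i).continuous.comp (by fun_prop)).subtype_mk _
  have : V.boundary i = range fun q : Circle × Circle =>
      (⟨V.param i (q.1, q.2), hmem q⟩ : V.exterior) := by
    ext y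
    simp only [boundary, V.frontier_solidTorus, mem_ofPred, mem_range, mem_image, Subtype.ext_iff]
    constructor
    · rintro ⟨q, hq, hy⟩
      exact ⟨(q.1, ⟨q.2, by simpa [Submonoid.unitSphere] using hq⟩), hy⟩
    · rintro ⟨q, hy⟩
      exact ⟨(q.1, q.2), Circle.norm_coe _, hy⟩
  rw [this]
  exact isPathConnected_range hcont

/-- The cores of the solid tori. -/
def cores : Set S3 := ⋃ i, V.param i '' {q | q.2 = 0}

theorem isClosed_cores : IsClosed V.cores := by
  have : IsCompact {q : Circle × ℂ | q.2 = 0} := by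
    have : {q : Circle × ℂ | q.2 = 0} = univ ×ˢ {0} := by ext; simp
    rw [this]
    exact isCompact_univ.prod isCompact_singleton
  exact (isCompact_iUnion fun i => this.image (V.isOpenEmbedding i).continuous).isClosed

theorem notMem_cores_of_mem_exterior {y : S3} (hy : y ∈ V.exterior) : y ∉ V.cores := by
  simp only [cores, mem_iUnion, not_exists]
  rintro i ⟨q, hq, rfl⟩
  have := V.param_mem_exterior.1 hy
  rw [mem_ofPred.1 hq, norm_zero] at this
  exact absurd this (by norm_num)

theorem exists_mem_solidTorus_of_mem_cores {y : S3} (hy : y ∈ V.cores) : ∃ i, y ∈ V.solidTorus i := by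
  obtain ⟨i, q, hq, rfl⟩ := mem_iUnion.1 hy
  exact ⟨i, q, by simp [mem_ofPred.1 hq], rfl⟩

end Link.TubularNeighbourhood

/-! ### The radial retraction onto the exterior. -/

/-- The radial retraction of the punctured plane onto the complement of the open unit disc, with
value `1` at the centre. -/
noncomputable def radialPush (w : ℂ) : ℂ := if w = 0 then 1 else w / (min ‖w‖ 1 : ℝ)

theorem norm_radialPush (w : ℂ) : ‖radialPush w‖ = max ‖w‖ 1 := by
  unfold radialPush
  split_ifs with h
  · simp [h]
  · have hw : 0 < ‖w‖ := norm_pos_iff.2 h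
    rw [norm_div, Complex.norm_real, Real.norm_of_nonneg (by positivity)]
    rcases le_total ‖w‖ 1 with h1 | h1
    · rw [min_eq_left h1, max_eq_right h1, div_self hw.ne']
    · rw [min_eq_right h1, max_eq_left h1, div_one]

theorem radialPush_of_one_le {w : ℂ} (h : 1 ≤ ‖w‖) : radialPush w = w := by
  have : w ≠ 0 := norm_pos_iff.1 (by linarith)
  simp [radialPush, this, min_eq_right h]

theorem continuousAt_radialPush {w : ℂ} (h : w ≠ 0) : ContinuousAt radialPush w := by
  have h1 : ContinuousAt (fun w : ℂ => w / ((min ‖w‖ 1 : ℝ) : ℂ)) w := by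
    refine ContinuousAt.div continuousAt_id (by fun_prop) ?_
    have : 0 < min ‖w‖ 1 := lt_min (norm_pos_iff.2 h) one_pos
    exact_mod_cast this.ne'
  refine h1.congr ?_
  filter_upwards [isOpen_ne.mem_nhds h] with z hz
  rw [radialPush, if_neg hz]

namespace Link.TubularNeighbourhood

variable {c : ℕ} {L : Link c} (V : L.TubularNeighbourhood)

open Classical in
/-- The retraction of the sphere onto the link exterior that is radial on the solid tori; it is
continuous outside of the link. -/
noncomputable def retraction (y : S3) : V.exterior :=
  if h : ∃ (i : Fin c) (q : Circle × ℂ), V.param i q = y then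
    ⟨V.param h.choose (h.choose_spec.choose.1, radialPush h.choose_spec.choose.2),
      V.param_mem_exterior.2 (by rw [norm_radialPush]; exact le_max_right _ _)⟩
  else ⟨y, by
    simp only [exterior, solidTorus, mem_compl_iff, mem_iUnion, not_exists]
    rintro i ⟨q, -, hq⟩
    exact h ⟨i, q, hq⟩⟩

theorem retraction_param (i : Fin c) (q : Circle × ℂ) :
    (V.retraction (V.param i q) : S3) = V.param i (q.1, radialPush q.2) := by
  have h : ∃ (j : Fin c) (q' : Circle × ℂ), V.param j q' = V.param i q := ⟨i, q, rfl⟩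
  obtain ⟨h1, h2⟩ := V.eq_of_param_eq h.choose_spec.choose_spec
  rw [retraction, dif_pos h]
  change V.param h.choose (h.choose_spec.choose.1, radialPush h.choose_spec.choose.2) = _
  rw [h2, h1]

theorem retraction_of_mem {y : S3} (hy : y ∈ V.exterior) : V.retraction y = ⟨y, hy⟩ := by
  by_cases h : ∃ (i : Fin c) (q : Circle × ℂ), V.param i q = y
  · obtain ⟨i, q, rfl⟩ := h
    apply Subtype.ext
    rw [V.retraction_param, radialPush_of_one_le (V.param_mem_exterior.1 hy)]
  · rw [retraction, dif_neg h]

/-- This includes the core, so a trivialization over the boundary torus serves on the whole solid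
torus despite the discontinuity there. -/
theorem mapsTo_retraction (i : Fin c) :
    MapsTo V.retraction (V.solidTorus i) (V.boundary i) := by
  rintro _ ⟨q, hq, rfl⟩
  rw [boundary, mem_ofPred, V.retraction_param, V.frontier_solidTorus]
  refine ⟨_, ?_, rfl⟩
  rw [mem_ofPred, norm_radialPush]
  exact max_eq_right (le_of_lt hq)

theorem continuousAt_retraction {y : S3} (hy : y ∉ V.cores) : ContinuousAt V.retraction y := by
  rw [IsInducing.subtypeVal.continuousAt_iff]
  by_cases h : ∃ (i : Fin c) (q : Circle × ℂ), V.param i q = y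
  · obtain ⟨i, q, rfl⟩ := h
    rw [← (V.isOpenEmbedding i).continuousAt_iff]
    have hq : q.2 ≠ 0 := fun hq => hy (mem_iUnion.2 ⟨i, q, hq, rfl⟩)
    have h1 : ContinuousAt (fun q : Circle × ℂ => V.param i (q.1, radialPush q.2)) q :=
      (V.isOpenEmbedding i).continuous.continuousAt.comp
        (continuousAt_fst.prodMk ((continuousAt_radialPush hq).comp continuousAt_snd))
    exact h1.congr (.of_forall fun q' => (V.retraction_param i q').symm)
  · have hO : IsClosed (⋃ i, V.param i '' (univ ×ˢ Metric.closedBall 0 1)) :=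
      (isCompact_iUnion fun i => (isCompact_univ.prod (isCompact_closedBall _ _)).image
        (V.isOpenEmbedding i).continuous).isClosed
    refine continuousAt_id.congr ?_
    filter_upwards [hO.isOpen_compl.mem_nhds (x := y) (by
      simp only [mem_compl_iff, mem_iUnion, not_exists]
      rintro i ⟨q, -, hq⟩
      exact h ⟨i, q, hq⟩)] with z hz
    have hz' : z ∈ V.exterior := by
      refine fun hz' => hz ?_
      obtain ⟨i, q, hq, rfl⟩ := mem_iUnion.1 hz'
      exact mem_iUnion.2 ⟨i, q, ⟨trivial, by simpa using (le_of_lt hq : ‖q.2‖ ≤ 1)⟩, rfl⟩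
    simp [V.retraction_of_mem hz']

/-- Connectedness descends from S³: a continuous map from the exterior to a discrete space is
constant on each boundary torus, so its composite with the retraction is constant on each solid
torus and hence continuous on the cores too. -/
theorem preconnectedSpace_exterior : PreconnectedSpace V.exterior := by
  refine preconnectedSpace_of_forall_constant fun f hf => ?_
  have h : Continuous (f ∘ V.retraction) := by
    rw [continuous_iff_continuousAt]
    intro y
    by_cases hy : y ∈ V.cores
    · obtain ⟨i, hi⟩ := V.exists_mem_solidTorus_of_mem_cores hy
      refine (continuousAt_const (y := f (V.retraction y))).congr ?_
      filter_upwards [(V.isOpen_solidTorus i).mem_nhds hi] with z hz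
      exact (V.isPathConnected_boundary i).isConnected.isPreconnected.constant hf.continuousOn
        (V.mapsTo_retraction i hi) (V.mapsTo_retraction i hz)
    · exact hf.continuousAt.comp (V.continuousAt_retraction hy)
  intro x y
  have := PreconnectedSpace.constant inferInstance h (x := (x : S3)) (y := (y : S3))
  simpa [V.retraction_of_mem x.2, V.retraction_of_mem y.2] using this

/-! ### Sections over the exterior, and the conclusion. -/

/-- A covering of the link exterior that is trivial over each of the boundary tori has a section
through any given point. -/
theorem exists_section {E F : Type*} [TopologicalSpace E] [TopologicalSpace F]
    [DiscreteTopology F] {p : C(E, V.exterior)} (hp : IsCoveringMap p)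
    (hF : ∀ y, Nonempty (p ⁻¹' {y} ≃ F))
    (Φ : ∀ i, p ⁻¹' V.boundary i ≃ₜ V.boundary i × F) (hΦ : ∀ i z, ((Φ i z).1 : V.exterior) = p z)
    (e : E) : ∃ s : C(V.exterior, E), (∀ y, p (s y) = y) ∧ s (p e) = e := by
  -- There is one chart for each point off the cores, pulled back from an evenly covered set and
  -- avoiding the cores, and one for each solid torus.
  have data : ∀ j : ((V.cores)ᶜ : Set S3) ⊕ Fin c, ∃ (S : Set S3) (N : Set V.exterior)
      (Ψ : p ⁻¹' N ≃ₜ N × F), IsOpen S ∧ MapsTo V.retraction S N ∧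
        (∀ z, ((Ψ z).1 : V.exterior) = p z) ∧
        Sum.elim (fun y : ((V.cores)ᶜ : Set S3) => (y : S3) ∈ S ∧ S ⊆ (V.cores)ᶜ)
          (fun i => S = V.solidTorus i) j := by
    rintro (⟨y, hy⟩ | i)
    · obtain ⟨hd, -⟩ := hp (V.retraction y)
      obtain ⟨f⟩ := hF (V.retraction y)
      obtain ⟨-, W, hyW, hW, -, H, hH⟩ :=
        (hp (V.retraction y)).of_fiber_homeomorph f.toHomeomorphOfDiscrete
      refine ⟨(V.cores)ᶜ ∩ V.retraction ⁻¹' W, W, H, ?_, fun z hz => hz.2, hH,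
        ⟨hy, hyW⟩, inter_subset_left⟩
      exact ContinuousOn.isOpen_inter_preimage
        (fun z hz => (V.continuousAt_retraction hz).continuousWithinAt)
        V.isClosed_cores.isOpen_compl hW
    · exact ⟨_, _, Φ i, V.isOpen_solidTorus i, V.mapsTo_retraction i, hΦ i, rfl⟩
  choose S N Ψ hS hr hΨ hspec using data
  have hcont : ∀ T ⊆ (V.cores)ᶜ, ContinuousOn V.retraction T := fun T hT z hz =>
    (V.continuousAt_retraction (hT hz)).continuousWithinAt
  have hcover : ∀ y, ∃ j, y ∈ S j := by
    intro y
    by_cases hy : y ∈ V.cores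
    · obtain ⟨i, hi⟩ := V.exists_mem_solidTorus_of_mem_cores hy
      exact ⟨.inr i, (hspec (.inr i) : S (.inr i) = _) ▸ hi⟩
    · exact ⟨.inl ⟨y, hy⟩, (hspec (.inl ⟨y, hy⟩)).1⟩
  have hoverlap : ∀ j k, j ≠ k → ContinuousOn V.retraction (S j ∩ S k) := by
    intro j k hjk
    rcases j with j | j
    · exact hcont _ (inter_subset_left.trans (hspec (.inl j)).2)
    rcases k with k | k
    · exact hcont _ (inter_subset_right.trans (hspec (.inl k)).2)
    -- Only solid tori contain core points and they are disjoint, so no overlap of distinct charts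
    -- meets the cores.
    have : S (.inr j) ∩ S (.inr k) = ∅ := by
      rw [(hspec (.inr j) : S (.inr j) = _), (hspec (.inr k) : S (.inr k) = _)]
      have hjk' : j ≠ k := fun h => hjk (by rw [h])
      exact ((V.disjoint hjk').mono (image_subset_range _ _)
        (image_subset_range _ _)).inter_eq
    rw [this]
    exact continuousOn_empty _
  obtain ⟨s, hps, hse, hsc⟩ := HasCoveringSections.onePoint_euclideanSpace.exists_lift hS
    hcover hr Ψ hΨ hoverlap (V.retraction_of_mem (p e).2).symm
  refine ⟨⟨fun y => s y, ?_⟩, fun y => (hps y).trans (V.retraction_of_mem y.2), hse⟩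
  rw [continuous_iff_continuousAt]
  intro y
  have hy := V.notMem_cores_of_mem_exterior y.2
  obtain ⟨h1, h2⟩ := hspec (.inl ⟨y, hy⟩)
  have h3 : ContinuousAt s y := (hsc _ (hcont _ h2)).continuousAt ((hS _).mem_nhds h1)
  exact h3.comp continuous_subtype_val.continuousAt

end Link.TubularNeighbourhood

/-- A covering of a preconnected space with nonempty total space is surjective. -/
theorem IsCoveringMap.surjective_of_preconnectedSpace {X E : Type*} [TopologicalSpace X]
    [TopologicalSpace E] [PreconnectedSpace X] [Nonempty E] {p : E → X} (hp : IsCoveringMap p) :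
    Function.Surjective p := by
  rw [← range_eq_univ]
  refine IsClopen.eq_univ ⟨⟨isOpen_iff_mem_nhds.2 fun y hy => ?_⟩, hp.isOpenMap.isOpen_range⟩
    (range_nonempty p)
  obtain ⟨-, W, hyW, hW, -, H, hH⟩ := hp y
  refine Filter.mem_of_superset (hW.mem_nhds hyW) ?_
  rintro z hz ⟨ε, rfl⟩
  -- A point over the evenly covered set `W` would have a fibre coordinate in the fibre over `y`,
  -- which is empty.
  exact hy ⟨(H ⟨ε, hz⟩).2, (H ⟨ε, hz⟩).2.2⟩
theorem mainTheorem6 {c : ℕ} (hc : 0 < c) (K : Link c) (hK : K.IsTame)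
    (V : K.TubularNeighbourhood) (hV : V.IsPeripherallyNontrivial)
    (x : V.exterior) (U : Subgroup (V.group x)) [U.Normal] [U.FiniteIndex]
    {E : Type*} [TopologicalSpace E] (p : C(E, V.exterior)) (e : E)
    (hp : IsCoveringInducedBy U p e) :
    U = ⊤ ↔ ∀ i : Fin c, Nat.card (ConnectedComponents (p ⁻¹' V.boundary i)) = U.index := by
  have hcov := hp.isCoveringMap
  have hpc := hp.pathConnectedSpace
  have hX := V.preconnectedSpace_exterior
  have hcard := hp.card_fiber
  have hpe := hp.map_eq
  have hsurj : Function.Surjective p := hcov.surjective_of_preconnectedSpace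
  have hfib : ∀ y, Nonempty (p ⁻¹' {y} ≃ p ⁻¹' {x}) := fun y => by
    obtain ⟨ε, rfl⟩ := hsurj y
    rw [← hpe]
    exact hcov.nonempty_fiber_equiv ε e
  have hfib' : ∀ y, Nat.card (p ⁻¹' {y}) = Nat.card (p ⁻¹' {x}) := fun y =>
    Nat.card_congr (hfib y).some
  constructor
  · intro hU i
    rw [hU, Subgroup.index_top] at hcard ⊢
    obtain ⟨y, hy⟩ := (V.isPathConnected_boundary i).nonempty
    obtain ⟨hsub, hne⟩ := Nat.card_eq_one_iff_unique.1 ((hfib' y).trans hcard)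
    have h := hcov.surjective_fiber_connectedComponents (V.isPathConnected_boundary i) hy
    exact Nat.card_eq_one_iff_unique.2 ⟨h.subsingleton, hne.elim fun z => ⟨.mk ⟨z, by rw [mem_preimage, z.2]; exact hy⟩⟩⟩
  · intro h
    have hd : DiscreteTopology (p ⁻¹' {x}) := (hcov x).1
    have hfin : Finite (p ⁻¹' {x}) :=
      Nat.finite_of_card_ne_zero (hcard ▸ Subgroup.FiniteIndex.index_ne_zero)
    have hne : Nonempty (p ⁻¹' {x}) := ⟨e, hpe⟩
    choose Φ hΦ using fun i => hcov.exists_homeomorph_prod (V.isPathConnected_boundary i)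
      (F := p ⁻¹' {x}) (fun y _ => hfib' y) ((h i).trans hcard.symm)
    obtain ⟨s, hs, hse⟩ := V.exists_section hcov hfib Φ hΦ e
    -- Both are lifts of `p` through itself that agree at `e`, and `E` is connected.
    have hid : s ∘ p = id := hcov.eq_of_comp_eq (s.continuous.comp p.continuous) continuous_id
      (funext fun ε => hs (p ε)) e hse
    rw [← Subgroup.index_eq_one, ← hcard, Nat.card_eq_one_iff_unique]
    refine ⟨⟨fun a b => Subtype.ext ?_⟩, hne⟩
    exact (congrFun hid a.1).symm.trans
      ((congrArg s (a.2.trans b.2.symm)).trans (congrFun hid b.1))
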